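/- **Conditional central limit theorem.** For each $n\ge 1$ let $W_{1n},\dots,W_{nn}$ be real random variables on a probability space $(\Omega_n,\mathcal G_n,\mathbb P_n)$ (which may vary with $n$), and let $\mathcal F_n\subseteq\mathcal G_n$ be a $\sigma$-algebra such that $W_{1n},\dots,W_{nn}$ are independent conditionally on $\mathcal F_n$. Assume that $0<\mathrm{Var}[W_{in}\mid\mathcal F_n]<\infty$ almost surely for all $n\ge 1$ and $1\le i\le n$, and put $$S_n^2=\sum_{i=1}^n \mathrm{Var}[W_{in}\mid\mathcal F_n],\qquad S_n\ge 0.$$ (Conditional expectations of nonnegative random variables take values in $[0,\infty]$; the $W_{in}$ need not be integrable, and $\mathbb E[W_{in}\mid\mathcal F_n]=\mathbb E[W_{in}^+\mid\mathcal F_n]-\mathbb E[W_{in}^-\mid\mathcal F_n]$, where both terms are almost surely finite because the conditional variance is.) If for some $\delta>0$ $$\frac{1}{S_n^{2+\delta}}\sum_{i=1}^n\mathbb E\bigl[\,|W_{in}-\mathbb E[W_{in}\mid\mathcal F_n]|^{2+\delta}\,\big|\,\mathcal F_n\bigr]\longrightarrow 0\quad\text{in probability},$$ then $$T_n=\frac1{S_n}\sum_{i=1}^n\bigl(W_{in}-\mathbb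 E[W_{in}\mid\mathcal F_n]\bigr)$$ converges in distribution to $N(0,1)$ conditionally on $\mathcal F_n$. That is, with $\Phi$ the distribution function of $N(0,1)$, for every $t\in\mathbb R$ (every $t$ is a continuity point of $\Phi$), $$\mathbb P_n[T_n\le t\mid\mathcal F_n]\longrightarrow\Phi(t)\quad\text{in probability as }n\to\infty.$$ Here $X_n\to c$ in probability, for $X_n$ defined on $\Omega_n$ and a constant $c$, means $\mathbb P_n[|X_n-c|\ge\varepsilon]\to 0$ for every $\varepsilon>0$. -/

import Mathlib

open MeasureTheory ProbabilityTheory Filter Topology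
open scoped ENNReal

namespace CondCLT

/-- Convergence in probability to a constant `c`, for random variables `X n` that may each be
defined on a probability space of its own:
for every `ε > 0`, the probability of `{ω | ε ≤ dist (X n ω) c}` tends to `0`.
If all spaces coincide this is Mathlib's `TendstoInMeasure` with a constant limit, see
`tendstoInProb_iff_tendstoInMeasure`. -/
def TendstoInProb {Ω : ℕ → Type*} [∀ n, MeasurableSpace (Ω n)] (P : ∀ n, Measure (Ω n))
    {E : Type*} [EDist E] (X : ∀ n, Ω n → E) (c : E) : Prop :=
  ∀ ε : ℝ≥0∞, 0 < ε → Tendsto (fun n => P n {ω | ε ≤ edist (X n ω) c}) atTop (𝓝 0)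

theorem tendstoInProb_iff_tendstoInMeasure {Ω E : Type*} [MeasurableSpace Ω] [EDist E]
    (P : Measure Ω) (X : ℕ → Ω → E) (c : E) :
    TendstoInProb (fun _ => P) X c ↔ TendstoInMeasure P X atTop (fun _ => c) :=
  Iff.rfl

/-- The distance on `[0, ∞]` used above: the distance from `x` to `0` is `x`. -/
theorem edist_ennreal_zero (x : ℝ≥0∞) : edist x 0 = x := by
  induction x with
  | top => exact (ENNReal.edist_eq_top_iff _ _).2 ⟨ENNReal.top_ne_zero, Or.inl rfl⟩
  | coe x =>
    have h : edist (x : ℝ≥0∞) 0 = edist x (0 : NNReal) := rfl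
    rw [h, edist_nndist, NNReal.nndist_zero_eq_val']

section

variable {Ω : Type*} (m : MeasurableSpace Ω) {m0 : MeasurableSpace Ω} (P : Measure Ω)

/-- Conditional independence given the σ-algebra `m` of a finite family of real random variables:
`P(X i ∈ B i for all i | m) = ∏ i, P(X i ∈ B i | m)` almost surely, for all Borel sets `B i`.
(Mathlib's `iCondIndepFun` is this notion on a standard Borel space `Ω`.) -/
def CondIndependent {ι : Type*} [Fintype ι] (X : ι → Ω → ℝ) : Prop :=
  ∀ B : ι → Set ℝ, (∀ i, MeasurableSet (B i)) →
    P⟦⋂ i, X i ⁻¹' B i | m⟧ =ᵐ[P] ∏ i, P⟦X i ⁻¹' B i | m⟧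

/-- The conditional expectation `E[X | m] = E[X⁺ | m] - E[X⁻ | m]`, where the two terms are
conditional expectations of nonnegative random variables, with values in `[0, ∞]`.
It is meaningful as soon as both terms are almost surely finite, even if `X` is not integrable.
For integrable `X` it is the usual conditional expectation, see `condMean_ae_eq_condExp`. -/
noncomputable def condMean (X : Ω → ℝ) : Ω → ℝ := fun ω =>
  (condLExp m P (fun ω' => ENNReal.ofReal (X ω')) ω).toReal -
    (condLExp m P (fun ω' => ENNReal.ofReal (-X ω')) ω).toReal

/-- The conditional absolute central moment `E[|X - E[X | m]| ^ p | m]`, with values in `[0, ∞]`.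
For `p ≥ 1`, almost surely on the event where `E[|X| | m] = ∞` (there the value of `condMean` has
no meaning) it equals `∞`, because `condMean` is real-valued and `m`-measurable. -/
noncomputable def condCentralMoment (X : Ω → ℝ) (p : ℝ) : Ω → ℝ≥0∞ :=
  condLExp m P (fun ω => ‖X ω - condMean m P X ω‖ₑ ^ p)

/-- The conditional variance `Var[X | m] = E[(X - E[X | m]) ^ 2 | m]`, with values in `[0, ∞]`.
Where it is finite, so is `E[|X| | m]`, almost surely. -/
noncomputable def condVariance (X : Ω → ℝ) : Ω → ℝ≥0∞ :=
  condCentralMoment m P X 2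

/-- `S = (∑ i, Var[X i | m]) ^ (1 / 2)`, with values in `[0, ∞]`. -/
noncomputable def condScale {ι : Type*} [Fintype ι] (X : ι → Ω → ℝ) : Ω → ℝ≥0∞ := fun ω =>
  (∑ i, condVariance m P (X i) ω) ^ (1 / 2 : ℝ)

/-- The conditional Lyapunov ratio `S ^ (-(2 + δ)) * ∑ i, E[|X i - E[X i | m]| ^ (2 + δ) | m]`,
with values in `[0, ∞]`. -/
noncomputable def lyapunovRatio {ι : Type*} [Fintype ι] (X : ι → Ω → ℝ) (δ : ℝ) : Ω → ℝ≥0∞ :=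
  fun ω => (∑ i, condCentralMoment m P (X i) (2 + δ) ω) / condScale m P X ω ^ (2 + δ)

/-- The conditionally centered and scaled sum `S⁻¹ * ∑ i, (X i - E[X i | m])`. -/
noncomputable def standardizedSum {ι : Type*} [Fintype ι] (X : ι → Ω → ℝ) : Ω → ℝ := fun ω =>
  (condScale m P X ω).toReal⁻¹ * ∑ i, (X i ω - condMean m P (X i) ω)

theorem condMean_ae_eq_condExp {X : Ω → ℝ} (hX : Integrable X P) :
    condMean m P X =ᵐ[P] P[X | m] := by
  have h1 := toReal_condLExp m (μ := P) (f := fun ω => ENNReal.ofReal (X ω))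
    hX.aemeasurable.ennreal_ofReal hX.lintegral_lt_top.ne
  have h2 := toReal_condLExp m (μ := P) (f := fun ω => ENNReal.ofReal (-X ω))
    hX.neg.aemeasurable.ennreal_ofReal hX.neg.lintegral_lt_top.ne
  have h3 := condExp_sub (μ := P) (f := fun ω => (ENNReal.ofReal (X ω)).toReal)
    (g := fun ω => (ENNReal.ofReal (-X ω)).toReal)
    (by simpa [ENNReal.toReal_ofReal'] using hX.pos_part)
    (by simpa [ENNReal.toReal_ofReal'] using hX.neg_part) m
  have h4 : ((fun ω => (ENNReal.ofReal (X ω)).toReal) -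
      fun ω => (ENNReal.ofReal (-X ω)).toReal) = X := by
    ext ω
    simp only [Pi.sub_apply, ENNReal.toReal_ofReal']
    rcases le_total 0 (X ω) with h | h <;> simp [h]
  rw [h4] at h3
  filter_upwards [h1, h2, h3] with ω a b c
  simp only [condMean, a, b, c, Pi.sub_apply]

end

/-- Convergence in distribution of `T n` to the law `ν` conditionally on the σ-algebras `F n`:
at every continuity point `t` of the distribution function of `ν`, the conditional distribution
functions `P(T n ≤ t | F n)` converge in probability to `ν (-∞, t]`. -/
def CondTendstoInDistribution {Ω : ℕ → Type*} (F : ∀ n, MeasurableSpace (Ω n))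
    [mΩ : ∀ n, MeasurableSpace (Ω n)] (P : ∀ n, Measure (Ω n)) (T : ∀ n, Ω n → ℝ)
    (ν : Measure ℝ) : Prop :=
  ∀ t : ℝ, ContinuousAt (cdf ν) t →
    TendstoInProb P (fun n => (P n)⟦{ω | T n ω ≤ t} | F n⟧) (cdf ν t)

end CondCLT

/-! Conditioning reduces the theorem to the classical Lyapunov theorem applied pointwise. The vector
of the `W n i` takes values in a standard Borel space, so it has a regular conditional law given `F
n` on any probability space. Almost surely this law is a product (`condLaw_ae_eq_pi`), its marginals
have the conditional means and central moments as their own (`condMean_ae_eq`,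
`condCentralMoment_ae_eq`), and it gives the conditional distribution function of the standardized
sum (`condProb_standardizedSum_ae_eq`).

The classical theorem is needed in uniform form (`exists_lyapunov_bound`): given `t` and `ε`, one
threshold `η` serves all finite families of laws. Up to a null set, the event that the conditional
distribution function is at least `ε` away from the normal one then lies in the event that the
Lyapunov ratio is at least `η`, whose probability tends to 0. No subsequences or common probability
space are needed. -/

namespace CondCLT

/-! ### Elementary inequalities and the Taylor remainder -/

/-- A product of complex numbers of norm at most `1` is `1`-Lipschitz in each factor. -/
theorem norm_prod_sub_prod_le_sum {ι : Type*} (s : Finset ι) (a b : ι → ℂ)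
    (ha : ∀ i, ‖a i‖ ≤ 1) (hb : ∀ i, ‖b i‖ ≤ 1) :
    ‖∏ i ∈ s, a i - ∏ i ∈ s, b i‖ ≤ ∑ i ∈ s, ‖a i - b i‖ := by
  classical
  induction s using Finset.induction_on with
  | empty => simp
  | insert j s hj ih =>
    rw [Finset.prod_insert hj, Finset.prod_insert hj, Finset.sum_insert hj]
    have hB : ‖∏ i ∈ s, b i‖ ≤ 1 := by
      rw [norm_prod]
      exact Finset.prod_le_one (fun i _ => norm_nonneg _) fun i _ => hb i
    calc ‖a j * ∏ i ∈ s, a i - b j * ∏ i ∈ s, b i‖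
        = ‖a j * (∏ i ∈ s, a i - ∏ i ∈ s, b i) + (a j - b j) * ∏ i ∈ s, b i‖ := by
          congr 1; ring
      _ ≤ ‖a j‖ * ‖∏ i ∈ s, a i - ∏ i ∈ s, b i‖ + ‖a j - b j‖ * ‖∏ i ∈ s, b i‖ := by
          refine (norm_add_le _ _).trans ?_
          rw [norm_mul, norm_mul]
      _ ≤ 1 * ∑ i ∈ s, ‖a i - b i‖ + ‖a j - b j‖ * 1 := by
          gcongr
          exact ha j
      _ = _ := by ring

/-- The remainder of the second order Taylor expansion of `exp (i y)`. -/
noncomputable def expTaylorRem (y : ℝ) : ℂ :=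
  Complex.exp (y * Complex.I) - (1 + y * Complex.I - (y : ℂ) ^ 2 / 2)

theorem norm_expTaylorRem_le_sq (y : ℝ) (hy : 1 ≤ |y|) : ‖expTaylorRem y‖ ≤ 4 * y ^ 2 := by
  have h1 : ‖expTaylorRem y‖ ≤ 1 + (1 + |y| + |y| ^ 2 / 2) := by
    unfold expTaylorRem
    refine (norm_sub_le _ _).trans ?_
    rw [Complex.norm_exp_ofReal_mul_I]
    gcongr
    refine (norm_sub_le _ _).trans ?_
    gcongr
    · refine (norm_add_le _ _).trans ?_
      simp
    · simp
  rw [← sq_abs y]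
  nlinarith

theorem norm_expTaylorRem_le_cube (y : ℝ) (hy : |y| ≤ 1) : ‖expTaylorRem y‖ ≤ 4 * |y| ^ 3 := by
  have h1 := Complex.norm_exp_sub_sum_le_norm_mul_exp (y * Complex.I) 3
  have h2 : expTaylorRem y = Complex.exp (y * Complex.I) -
      ∑ m ∈ Finset.range 3, (y * Complex.I) ^ m / m.factorial := by
    simp [expTaylorRem, Finset.sum_range_succ, mul_pow, Nat.factorial]
    ring
  rw [h2]
  refine h1.trans ?_
  have h3 : ‖(y : ℂ) * Complex.I‖ = |y| := by simp
  rw [h3, mul_comm]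
  gcongr
  have := Real.exp_le_exp.2 hy
  have := Real.exp_one_lt_d9
  linarith

theorem sq_le_rpow_of_lt {δ r : ℝ} (hδ : 0 < δ) (hr : 0 < r) {y : ℝ} (hy : r < |y|) :
    y ^ 2 ≤ r ^ (-δ) * |y| ^ (2 + δ) := by
  have hy0 : 0 < |y| := hr.trans hy
  rw [Real.rpow_add hy0, Real.rpow_two, sq_abs, Real.rpow_neg hr.le, inv_mul_eq_div,
    le_div_iff₀ (by positivity)]
  gcongr

theorem sq_le_sq_add_rpow {δ r : ℝ} (hδ : 0 < δ) (hr : 0 < r) (y : ℝ) :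
    y ^ 2 ≤ r ^ 2 + r ^ (-δ) * |y| ^ (2 + δ) := by
  rcases le_or_gt |y| r with h | h
  · have : y ^ 2 ≤ r ^ 2 := by rw [← sq_abs y]; gcongr
    have : 0 ≤ r ^ (-δ) * |y| ^ (2 + δ) := by positivity
    linarith
  · have := sq_le_rpow_of_lt hδ hr h
    nlinarith [sq_nonneg r]

/-- Truncation at level `r`: below it the cubic bound yields a factor `r` times `y ^ 2`, above it
the quadratic bound is absorbed by the moment of order `2 + δ`. Keeping `r` free covers every `δ >
0`, also `δ > 1`. -/
theorem norm_expTaylorRem_le {δ r : ℝ} (hδ : 0 < δ) (hr : 0 < r) (hr1 : r ≤ 1) (y : ℝ) :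
    ‖expTaylorRem y‖ ≤ 4 * (r * y ^ 2 + r ^ (-δ) * |y| ^ (2 + δ)) := by
  have hp : 0 ≤ r ^ (-δ) * |y| ^ (2 + δ) := by positivity
  rcases le_or_gt |y| r with h | h
  · refine (norm_expTaylorRem_le_cube y (h.trans hr1)).trans ?_
    have : |y| ^ 3 ≤ r * y ^ 2 := by
      rw [← sq_abs y, pow_succ']; gcongr
    linarith
  · have h0 := sq_le_rpow_of_lt hδ hr h
    have h1 : ‖expTaylorRem y‖ ≤ 4 * y ^ 2 := by
      rcases le_total |y| 1 with h1 | h1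
      · refine (norm_expTaylorRem_le_cube y h1).trans ?_
        rw [← sq_abs y]
        have := pow_le_pow_of_le_one (abs_nonneg y) h1 (show 2 ≤ 3 by norm_num)
        linarith
      · exact norm_expTaylorRem_le_sq y h1
    have : 0 ≤ r * y ^ 2 := by positivity
    linarith

/-! ### Characteristic functions of centered sums -/

theorem integrable_id_of_integrable_sq {ν : Measure ℝ} [IsFiniteMeasure ν]
    (h2 : Integrable (fun x : ℝ => x ^ 2) ν) : Integrable (fun x : ℝ => x) ν :=
  memLp_one_iff_integrable.1
    (((memLp_two_iff_integrable_sq measurable_id.aestronglyMeasurable).2 h2).mono_exponent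
      (by norm_num))

/-- The pointwise Taylor bound is integrated; centering removes the linear term. -/
theorem norm_charFun_sub_le {ν : Measure ℝ} [IsProbabilityMeasure ν] {δ r : ℝ} (hδ : 0 < δ)
    (hr : 0 < r) (hr1 : r ≤ 1) (h1 : ∫ x, x ∂ν = 0) (h2 : Integrable (fun x : ℝ => x ^ 2) ν)
    (h3 : Integrable (fun x : ℝ => |x| ^ (2 + δ)) ν) (u : ℝ) :
    ‖charFun ν u - (1 - (((u ^ 2 * ∫ x, x ^ 2 ∂ν) / 2 : ℝ) : ℂ))‖ ≤
      4 * (r * u ^ 2 * ∫ x, x ^ 2 ∂ν + r ^ (-δ) * |u| ^ (2 + δ) * ∫ x, |x| ^ (2 + δ) ∂ν) := by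
  have hx := integrable_id_of_integrable_sq h2
  have hexp : Integrable (fun x : ℝ => Complex.exp ((u * x : ℝ) * Complex.I)) ν := by
    refine Integrable.of_bound (C := 1) (by fun_prop) (ae_of_all _ fun x => ?_)
    rw [Complex.norm_exp_ofReal_mul_I]
  have hlin : Integrable (fun x : ℝ => ((u * x : ℝ) : ℂ) * Complex.I) ν :=
    ((hx.const_mul u).ofReal).mul_const _
  have hsq : Integrable (fun x : ℝ => ((u * x : ℝ) : ℂ) ^ 2 / 2) ν := by
    have := ((h2.const_mul (u ^ 2 / 2)).ofReal (𝕜 := ℂ))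
    refine this.congr (ae_of_all _ fun x => ?_)
    simp
    ring
  have hlin0 : ∫ x : ℝ, ((u * x : ℝ) : ℂ) * Complex.I ∂ν = 0 := by
    rw [integral_mul_const, integral_complex_ofReal, integral_const_mul, h1]
    simp
  have hsq0 : ∫ x : ℝ, ((u * x : ℝ) : ℂ) ^ 2 / 2 ∂ν = (((u ^ 2 * ∫ x, x ^ 2 ∂ν) / 2 : ℝ) : ℂ) := by
    rw [← integral_const_mul, ← integral_div, ← integral_complex_ofReal]
    refine integral_congr_ae (ae_of_all _ fun x => ?_)
    simp
    ring
  have key : ∫ x, expTaylorRem (u * x) ∂ν =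
      charFun ν u - (1 - (((u ^ 2 * ∫ x, x ^ 2 ∂ν) / 2 : ℝ) : ℂ)) := by
    unfold expTaylorRem
    have e1 : Integrable (fun x : ℝ => 1 + ((u * x : ℝ) : ℂ) * Complex.I) ν :=
      (integrable_const (1 : ℂ)).add hlin
    have e2 : Integrable (fun x : ℝ =>
        1 + ((u * x : ℝ) : ℂ) * Complex.I - ((u * x : ℝ) : ℂ) ^ 2 / 2) ν := e1.sub hsq
    rw [integral_sub hexp e2, integral_sub e1 hsq, integral_add (integrable_const (1 : ℂ)) hlin,
      hlin0, hsq0, charFun_apply_real]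
    simp
  rw [← key, mul_add, ← integral_const_mul, ← integral_const_mul, ← integral_const_mul,
    ← integral_const_mul,
    ← integral_add ((h2.const_mul _).const_mul _) ((h3.const_mul _).const_mul _)]
  refine norm_integral_le_of_norm_le
    (((h2.const_mul _).const_mul _).add ((h3.const_mul _).const_mul _)) (ae_of_all _ fun x => ?_)
  refine (norm_expTaylorRem_le hδ hr hr1 (u * x)).trans_eq ?_
  rw [abs_mul, Real.mul_rpow (abs_nonneg _) (abs_nonneg _)]
  ring

theorem abs_exp_neg_sub_le {s : ℝ} (hs : 0 ≤ s) : |1 - s - Real.exp (-s)| ≤ s ^ 2 := by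
  rcases le_total s 1 with h | h
  · have := Real.norm_exp_sub_one_sub_id_le (x := -s) (by simpa [abs_of_nonneg hs])
    rw [Real.norm_eq_abs, Real.norm_eq_abs, abs_neg, sq_abs, abs_sub_comm] at this
    convert! this using 2
    ring_nf
  · have h1 := Real.exp_pos (-s)
    have h2 : Real.exp (-s) ≤ 1 := Real.exp_le_one_iff.2 (by linarith)
    rw [abs_le]
    constructor <;> nlinarith

/-- The characteristic function of a sum of independent centered variables with variances adding
up to `1` is close to that of the standard normal law if the Lyapunov sum `L` is small. -/
theorem norm_charFun_sum_sub_le {ι : Type*} [Fintype ι] {μ : ι → Measure ℝ}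
    [∀ i, IsProbabilityMeasure (μ i)] {δ r : ℝ} (hδ : 0 < δ) (hr : 0 < r) (hr1 : r ≤ 1)
    (h1 : ∀ i, ∫ x, x ∂(μ i) = 0) (h2 : ∀ i, Integrable (fun x : ℝ => x ^ 2) (μ i))
    (h3 : ∀ i, Integrable (fun x : ℝ => |x| ^ (2 + δ)) (μ i))
    (hsum : ∑ i, ∫ x, x ^ 2 ∂(μ i) = 1) {L : ℝ}
    (hL : ∑ i, ∫ x, |x| ^ (2 + δ) ∂(μ i) ≤ L) (u : ℝ) :
    ‖charFun ((Measure.pi μ).map fun x => ∑ i, x i) u - charFun (gaussianReal 0 1) u‖ ≤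
      4 * (r * u ^ 2 + r ^ (-δ) * |u| ^ (2 + δ) * L) + u ^ 4 * (r ^ 2 + r ^ (-δ) * L) := by
  set V : ι → ℝ := fun i => ∫ x, x ^ 2 ∂(μ i) with hV
  set K : ι → ℝ := fun i => ∫ x, |x| ^ (2 + δ) ∂(μ i) with hK
  have hV0 : ∀ i, 0 ≤ V i := fun i => integral_nonneg fun x => sq_nonneg x
  have hK0 : ∀ i, 0 ≤ K i := fun i => integral_nonneg fun x => by positivity
  have hKL : ∀ i, K i ≤ L := fun i =>
    (Finset.single_le_sum (f := K) (fun i _ => hK0 i) (Finset.mem_univ i)).trans hL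
  -- Each variance is uniformly small. This controls the sum of the squares `V i ^ 2`, since the `V
  -- i` add up to 1.
  have hVK : ∀ i, V i ≤ r ^ 2 + r ^ (-δ) * L := by
    intro i
    calc V i ≤ ∫ x, (r ^ 2 + r ^ (-δ) * |x| ^ (2 + δ)) ∂(μ i) :=
          integral_mono (h2 i) ((integrable_const _).add ((h3 i).const_mul _))
            fun x => sq_le_sq_add_rpow hδ hr x
      _ = r ^ 2 + r ^ (-δ) * K i := by
          rw [integral_add (integrable_const _) ((h3 i).const_mul _), integral_const_mul]
          simp [hK]
      _ ≤ _ := by gcongr; exact hKL i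
  have hgauss : charFun (gaussianReal 0 1) u =
      ∏ i, ((Real.exp (-(u ^ 2 * V i / 2)) : ℝ) : ℂ) := by
    rw [charFun_gaussianReal, ← Complex.ofReal_prod, ← Real.exp_sum, Finset.sum_neg_distrib,
      ← Finset.sum_div, ← Finset.mul_sum, hsum]
    simp
  rw [charFun_map_sum_pi_eq_prod, hgauss, Finset.prod_apply]
  refine (norm_prod_sub_prod_le_sum _ _ _ (fun i => norm_charFun_le_one u) fun i => ?_).trans ?_
  · rw [Complex.norm_real, Real.norm_eq_abs, Real.abs_exp]
    refine Real.exp_le_one_iff.2 ?_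
    have := hV0 i
    have : 0 ≤ u ^ 2 * V i / 2 := by positivity
    linarith
  have hterm : ∀ i, ‖charFun (μ i) u - ((Real.exp (-(u ^ 2 * V i / 2)) : ℝ) : ℂ)‖ ≤
      4 * (r * u ^ 2 * V i + r ^ (-δ) * |u| ^ (2 + δ) * K i) +
        u ^ 4 * (r ^ 2 + r ^ (-δ) * L) * V i := by
    intro i
    have hs : 0 ≤ u ^ 2 * V i / 2 := by have := hV0 i; positivity
    -- Both the characteristic function and the Gaussian factor are compared with `1 - u ^ 2 * V i /
    -- 2`.
    refine (norm_sub_le_norm_sub_add_norm_sub _ (1 - ((u ^ 2 * V i / 2 : ℝ) : ℂ)) _).trans ?_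
    gcongr ?_ + ?_
    · exact norm_charFun_sub_le hδ hr hr1 (h1 i) (h2 i) (h3 i) u
    · rw [← Complex.ofReal_one, ← Complex.ofReal_sub, ← Complex.ofReal_sub, Complex.norm_real,
        Real.norm_eq_abs]
      refine (abs_exp_neg_sub_le hs).trans ?_
      have h4 : V i * V i ≤ (r ^ 2 + r ^ (-δ) * L) * V i :=
        mul_le_mul_of_nonneg_right (hVK i) (hV0 i)
      have h5 : 0 ≤ V i * V i := mul_self_nonneg _
      have h6 : 0 ≤ u ^ 4 := by positivity
      calc (u ^ 2 * V i / 2) ^ 2 = u ^ 4 * (V i * V i / 4) := by ring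
        _ ≤ u ^ 4 * ((r ^ 2 + r ^ (-δ) * L) * V i) := by gcongr; linarith
        _ = _ := by ring
  refine (Finset.sum_le_sum fun i _ => hterm i).trans ?_
  rw [Finset.sum_add_distrib, ← Finset.mul_sum, Finset.sum_add_distrib, ← Finset.mul_sum,
    ← Finset.mul_sum, ← Finset.mul_sum, hsum, mul_one, mul_one]
  gcongr

/-! ### Lyapunov's theorem, sequential and uniform -/

/-- **Lyapunov's central limit theorem** for triangular arrays of product measures. -/
theorem tendsto_charFun_sum_of_lyapunov {N : ℕ → ℕ} {μ : ∀ k, Fin (N k) → Measure ℝ}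
    [∀ k i, IsProbabilityMeasure (μ k i)] {δ : ℝ} (hδ : 0 < δ)
    (h1 : ∀ k i, ∫ x, x ∂(μ k i) = 0) (h2 : ∀ k i, Integrable (fun x : ℝ => x ^ 2) (μ k i))
    (h3 : ∀ k i, Integrable (fun x : ℝ => |x| ^ (2 + δ)) (μ k i))
    (hsum : ∀ k, ∑ i, ∫ x, x ^ 2 ∂(μ k i) = 1) {L : ℕ → ℝ}
    (hL : ∀ k, ∑ i, ∫ x, |x| ^ (2 + δ) ∂(μ k i) ≤ L k) (hL0 : Tendsto L atTop (𝓝 0)) (u : ℝ) :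
    Tendsto (fun k => charFun ((Measure.pi (μ k)).map fun x => ∑ i, x i) u) atTop
      (𝓝 (charFun (gaussianReal 0 1) u)) := by
  rw [tendsto_iff_norm_sub_tendsto_zero]
  refine tendsto_order.2 ⟨fun a ha => Eventually.of_forall fun k => ha.trans_le (norm_nonneg _),
    fun a ha => ?_⟩
  -- The truncation level is fixed first, making the part of the bound without `L k` less than `a`;
  -- for this `r` the remaining terms vanish as `k` grows.
  have hr : ∃ r : ℝ, (0 < r ∧ r ≤ 1) ∧ 4 * (r * u ^ 2) + u ^ 4 * r ^ 2 < a := by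
    have hc : Tendsto (fun r : ℝ => 4 * (r * u ^ 2) + u ^ 4 * r ^ 2) (𝓝[>] 0) (𝓝 0) := by
      have : Continuous fun r : ℝ => 4 * (r * u ^ 2) + u ^ 4 * r ^ 2 := by fun_prop
      simpa using (this.tendsto 0).mono_left nhdsWithin_le_nhds
    have hI : ∀ᶠ r : ℝ in 𝓝[>] 0, 0 < r ∧ r ≤ 1 := by
      filter_upwards [Ioc_mem_nhdsGT (zero_lt_one' ℝ)] with r hr using hr
    exact (hI.and (hc.eventually_lt_const ha)).exists
  obtain ⟨r, ⟨hr0, hr1⟩, hra⟩ := hr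
  have hlim : Tendsto (fun k => 4 * (r * u ^ 2 + r ^ (-δ) * |u| ^ (2 + δ) * L k) +
      u ^ 4 * (r ^ 2 + r ^ (-δ) * L k)) atTop (𝓝 (4 * (r * u ^ 2 + r ^ (-δ) * |u| ^ (2 + δ) * 0) +
      u ^ 4 * (r ^ 2 + r ^ (-δ) * 0))) :=
    (((hL0.const_mul _).const_add _).const_mul _).add
      (((hL0.const_mul _).const_add _).const_mul _)
  filter_upwards [hlim.eventually_lt_const (show _ < a by simpa using hra)] with k hk
  exact (norm_charFun_sum_sub_le hδ hr0 hr1 (h1 k) (h2 k) (h3 k) (hsum k) (hL k) u).trans_lt hk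

/-- Lévy's continuity theorem gives weak convergence, and the half-line has a Gaussian-null boundary
because the normal law has no atoms. -/
theorem tendsto_pi_sum_le_of_lyapunov {N : ℕ → ℕ} {μ : ∀ k, Fin (N k) → Measure ℝ}
    [∀ k i, IsProbabilityMeasure (μ k i)] {δ : ℝ} (hδ : 0 < δ)
    (h1 : ∀ k i, ∫ x, x ∂(μ k i) = 0) (h2 : ∀ k i, Integrable (fun x : ℝ => x ^ 2) (μ k i))
    (h3 : ∀ k i, Integrable (fun x : ℝ => |x| ^ (2 + δ)) (μ k i))
    (hsum : ∀ k, ∑ i, ∫ x, x ^ 2 ∂(μ k i) = 1) {L : ℕ → ℝ}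
    (hL : ∀ k, ∑ i, ∫ x, |x| ^ (2 + δ) ∂(μ k i) ≤ L k) (hL0 : Tendsto L atTop (𝓝 0)) (t : ℝ) :
    Tendsto (fun k => (Measure.pi (μ k)).real {x | ∑ i, x i ≤ t}) atTop
      (𝓝 (cdf (gaussianReal 0 1) t)) := by
  have hm : ∀ k, Measurable fun x : Fin (N k) → ℝ => ∑ i, x i := fun k => by fun_prop
  have hp : ∀ k, IsProbabilityMeasure ((Measure.pi (μ k)).map fun x => ∑ i, x i) := fun k =>
    Measure.isProbabilityMeasure_map (hm k).aemeasurable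
  let ν : ℕ → ProbabilityMeasure ℝ := fun k => ⟨(Measure.pi (μ k)).map fun x => ∑ i, x i, hp k⟩
  let γ : ProbabilityMeasure ℝ := ⟨gaussianReal 0 1, inferInstance⟩
  have hconv : Tendsto ν atTop (𝓝 γ) := ProbabilityMeasure.tendsto_iff_tendsto_charFun.2
    fun u => tendsto_charFun_sum_of_lyapunov hδ h1 h2 h3 hsum hL hL0 u
  have hfr : (γ : Measure ℝ) (frontier (Set.Iic t)) = 0 := by
    have : NullSingletonClass (gaussianReal 0 1) := nullSingletonClass_gaussianReal one_ne_zero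
    rw [frontier_Iic]
    exact measure_singleton (μ := gaussianReal 0 1) t
  have h := ProbabilityMeasure.tendsto_measure_of_null_frontier_of_tendsto' hconv hfr
  have h' := (ENNReal.tendsto_toReal (measure_ne_top _ _)).comp h
  rw [cdf_eq_real]
  refine h'.congr fun k => ?_
  simp only [ν, Function.comp_apply, ProbabilityMeasure.coe_mk, measureReal_def]
  rw [Measure.map_apply (hm k) measurableSet_Iic]
  rfl

/-- Lyapunov's central limit theorem, uniformly over all finite families of laws. -/
theorem exists_lyapunov_bound {δ : ℝ} (hδ : 0 < δ) (t : ℝ) {ε : ℝ} (hε : 0 < ε) :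
    ∃ η : ℝ, 0 < η ∧ ∀ (n : ℕ) (μ : Fin n → Measure ℝ), (∀ i, IsProbabilityMeasure (μ i)) →
      (∀ i, ∫ x, x ∂(μ i) = 0) → (∀ i, Integrable (fun x : ℝ => x ^ 2) (μ i)) →
      (∀ i, Integrable (fun x : ℝ => |x| ^ (2 + δ)) (μ i)) → ∑ i, ∫ x, x ^ 2 ∂(μ i) = 1 →
      ∑ i, ∫ x, |x| ^ (2 + δ) ∂(μ i) ≤ η →
      dist ((Measure.pi μ).real {x | ∑ i, x i ≤ t}) (cdf (gaussianReal 0 1) t) < ε := by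
  by_contra! hcon
  -- Counterexamples for the thresholds `1 / (k + 1)` form a triangular array with arbitrary row
  -- lengths `N k`, to which the sequential theorem applies.
  choose N μ hμ h1 h2 h3 hsum hL hfar using
    fun k : ℕ => hcon (1 / ((k : ℝ) + 1)) Nat.one_div_pos_of_nat
  have := tendsto_pi_sum_le_of_lyapunov hδ h1 h2 h3 hsum hL tendsto_one_div_add_atTop_nhds_zero_nat t
  obtain ⟨k, hk⟩ := (Metric.tendsto_nhds.1 this ε hε).exists
  exact absurd hk (not_lt.2 (hfar k))

/-! ### Standardization and moments in `[0, ∞]` -/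

theorem ofReal_abs_rpow {p : ℝ} (hp : 0 ≤ p) (x : ℝ) : ENNReal.ofReal (|x| ^ p) = ‖x‖ₑ ^ p := by
  rw [Real.enorm_eq_ofReal_abs, ENNReal.ofReal_rpow_of_nonneg (abs_nonneg x) hp]

theorem integrable_abs_rpow {α : Type*} {mα : MeasurableSpace α} {ν : Measure α} {f : α → ℝ}
    (hf : Measurable f) {p : ℝ} (hp : 0 ≤ p) (h : ∫⁻ x, ‖f x‖ₑ ^ p ∂ν ≠ ∞) :
    Integrable (fun x => |f x| ^ p) ν := by
  refine ⟨by fun_prop, ?_⟩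
  rw [hasFiniteIntegral_iff_ofReal (ae_of_all _ fun x => by positivity)]
  simp_rw [ofReal_abs_rpow hp]
  exact h.lt_top

theorem integral_abs_rpow {α : Type*} {mα : MeasurableSpace α} {ν : Measure α} {f : α → ℝ}
    (hf : Measurable f) {p : ℝ} (hp : 0 ≤ p) :
    ∫ x, |f x| ^ p ∂ν = (∫⁻ x, ‖f x‖ₑ ^ p ∂ν).toReal := by
  rw [integral_eq_lintegral_of_nonneg_ae (ae_of_all _ fun x => by positivity) (by fun_prop)]
  simp_rw [ofReal_abs_rpow hp]

theorem integrable_of_lintegral_sub_sq_ne_top {α : Type*} {mα : MeasurableSpace α} {ν : Measure α}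
    [IsFiniteMeasure ν] {f : α → ℝ} (hf : Measurable f) {c : ℝ}
    (h : ∫⁻ x, ‖f x - c‖ₑ ^ (2 : ℝ) ∂ν ≠ ∞) : Integrable f ν := by
  have h2 := integrable_abs_rpow (f := fun x => f x - c) (by fun_prop) zero_le_two h
  simp_rw [Real.rpow_two, sq_abs] at h2
  have h3 : MemLp (fun x => f x - c) 2 ν :=
    (memLp_two_iff_integrable_sq (by fun_prop)).2 h2
  have h4 := (memLp_one_iff_integrable.1 (h3.mono_exponent (by norm_num))).add
    (integrable_const c)
  refine h4.congr (ae_of_all _ fun x => ?_)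
  simp

/-- The uniform Lyapunov central limit theorem for families of laws that need not be standardized,
with moments in `[0, ∞]`. -/
theorem exists_lyapunov_bound_of_lintegral {δ : ℝ} (hδ : 0 < δ) (t : ℝ) {ε : ℝ} (hε : 0 < ε) :
    ∃ η : ℝ≥0∞, 0 < η ∧ ∀ (n : ℕ) (κ : Fin n → Measure ℝ), (∀ i, IsProbabilityMeasure (κ i)) →
      ∀ (m : Fin n → ℝ) (S : ℝ≥0∞), (∀ i, ∫ x, x ∂(κ i) = m i) →
      S = (∑ i, ∫⁻ x, ‖x - m i‖ₑ ^ (2 : ℝ) ∂(κ i)) ^ (1 / 2 : ℝ) → S ≠ 0 → S ≠ ∞ →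
      (∑ i, ∫⁻ x, ‖x - m i‖ₑ ^ (2 + δ) ∂(κ i)) / S ^ (2 + δ) < η →
      dist ((Measure.pi κ).real {x | S.toReal⁻¹ * ∑ i, (x i - m i) ≤ t})
        (cdf (gaussianReal 0 1) t) < ε := by
  obtain ⟨η, hη, H⟩ := exists_lyapunov_bound hδ t hε
  refine ⟨ENNReal.ofReal η, ENNReal.ofReal_pos.2 hη, fun n κ hκ m S hm hS hS0 hST hlt => ?_⟩
  have hs : 0 < S.toReal := ENNReal.toReal_pos hS0 hST
  -- The uniform bound is applied to the images of the `κ i` under centering and division by `S`.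
  set f : Fin n → ℝ → ℝ := fun i x => S.toReal⁻¹ * (x - m i) with hf
  have hfm : ∀ i, Measurable (f i) := fun i => by fun_prop
  have hν : ∀ i, IsProbabilityMeasure ((κ i).map (f i)) := fun i =>
    Measure.isProbabilityMeasure_map (hfm i).aemeasurable
  have hmom : ∀ (p : ℝ), 0 ≤ p → ∀ i, ∫⁻ x, ‖x‖ₑ ^ p ∂((κ i).map (f i)) =
      (∫⁻ x, ‖x - m i‖ₑ ^ p ∂(κ i)) / S ^ p := by
    intro p hp i
    rw [lintegral_map (by fun_prop) (hfm i), div_eq_mul_inv, mul_comm,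
      ← lintegral_const_mul _ (by fun_prop)]
    refine lintegral_congr fun x => ?_
    rw [hf, enorm_mul, ENNReal.mul_rpow_of_nonneg _ _ hp, enorm_inv hs.ne',
      Real.enorm_of_nonneg hs.le, ENNReal.ofReal_toReal hST, ENNReal.inv_rpow]
  have hmomsum : ∀ (p : ℝ), 0 ≤ p → ∑ i, ∫⁻ x, ‖x‖ₑ ^ p ∂((κ i).map (f i)) =
      (∑ i, ∫⁻ x, ‖x - m i‖ₑ ^ p ∂(κ i)) / S ^ p := by
    intro p hp
    simp_rw [hmom p hp, div_eq_mul_inv, Finset.sum_mul]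
  have hS2 : S ^ (2 : ℝ) = ∑ i, ∫⁻ x, ‖x - m i‖ₑ ^ (2 : ℝ) ∂(κ i) := by
    rw [hS, ← ENNReal.rpow_mul]
    norm_num
  have hS2T : S ^ (2 : ℝ) ≠ ∞ := ENNReal.rpow_ne_top_of_nonneg zero_le_two hST
  have hS20 : S ^ (2 : ℝ) ≠ 0 := by simp [hS0]
  have hsum2 : ∑ i, ∫⁻ x, ‖x‖ₑ ^ (2 : ℝ) ∂((κ i).map (f i)) = 1 := by
    rw [hmomsum 2 zero_le_two, ← hS2, ENNReal.div_self hS20 hS2T]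
  -- Finiteness of each moment is read off from the finite sum.
  have hfin2 : ∀ i, ∫⁻ x, ‖x‖ₑ ^ (2 : ℝ) ∂((κ i).map (f i)) ≠ ∞ := fun i =>
    ENNReal.sum_ne_top.1 (hsum2 ▸ ENNReal.one_ne_top) i (Finset.mem_univ i)
  have hp : 0 ≤ 2 + δ := by linarith
  have hsum3 : ∑ i, ∫⁻ x, ‖x‖ₑ ^ (2 + δ) ∂((κ i).map (f i)) < ENNReal.ofReal η :=
    (hmomsum _ hp).trans_lt hlt
  have hfin3 : ∀ i, ∫⁻ x, ‖x‖ₑ ^ (2 + δ) ∂((κ i).map (f i)) ≠ ∞ := fun i =>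
    ENNReal.sum_ne_top.1 hsum3.ne_top i (Finset.mem_univ i)
  have hsq : ∀ x : ℝ, x ^ 2 = |x| ^ (2 : ℝ) := fun x => by rw [Real.rpow_two, sq_abs]
  have hint : ∀ i, Integrable (fun x : ℝ => x) (κ i) := fun i => by
    refine integrable_of_lintegral_sub_sq_ne_top (c := m i) measurable_id ?_
    exact ENNReal.sum_ne_top.1 (hS2 ▸ hS2T) i (Finset.mem_univ i)
  have key := H n (fun i => (κ i).map (f i)) hν ?_ ?_ ?_ ?_ ?_
  · rw [← Measure.pi_map_pi fun i => (hfm i).aemeasurable, measureReal_def,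
      Measure.map_apply (by fun_prop) (measurableSet_le (by fun_prop) (by fun_prop))] at key
    simpa only [hf, Set.preimage_ofPred_eq, ← Finset.mul_sum, measureReal_def] using key
  · intro i
    rw [integral_map (hfm i).aemeasurable (by fun_prop), integral_const_mul,
      integral_sub (hint i) (integrable_const _), hm i]
    simp
  · intro i
    simp_rw [hsq]
    exact integrable_abs_rpow measurable_id zero_le_two (hfin2 i)
  · intro i
    exact integrable_abs_rpow measurable_id hp (hfin3 i)
  · simp_rw [hsq, integral_abs_rpow measurable_id' zero_le_two]
    rw [← ENNReal.toReal_sum fun i _ => hfin2 i, hsum2, ENNReal.toReal_one]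
  · simp_rw [integral_abs_rpow measurable_id' hp]
    rw [← ENNReal.toReal_sum fun i _ => hfin3 i]
    exact ENNReal.toReal_le_of_le_ofReal hη.le hsum3.le

/-! ### Regular conditional laws given a σ-algebra -/

/-- Over an event `X ⁻¹' t` both sides have the same integral, because the law of `X` composed with
`condDistrib Y X μ` is the joint law of `(X, Y)`. -/
theorem lintegral_condDistrib_ae_eq_condLExp {α β E : Type*} [MeasurableSpace E]
    [StandardBorelSpace E] [Nonempty E] {mα : MeasurableSpace α} {mβ : MeasurableSpace β}
    {μ : Measure α} [IsFiniteMeasure μ] {X : α → β} {Y : α → E} (hX : Measurable X)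
    (hY : Measurable Y) {f : β × E → ℝ≥0∞} (hf : Measurable f) :
    (fun a => ∫⁻ y, f (X a, y) ∂(condDistrib Y X μ (X a))) =ᵐ[μ]
      condLExp (mβ.comap X) μ (fun a => f (X a, Y a)) := by
  have hg : Measurable fun b => ∫⁻ y, f (b, y) ∂(condDistrib Y X μ b) :=
    hf.lintegral_kernel_prod_right'
  refine ae_eq_condLExp hX.comap_le μ _ (hg.comp (comap_measurable X)) ?_
  rintro _ ⟨t, ht, rfl⟩
  have hXY : Measurable fun a => (X a, Y a) := hX.prodMk hY
  have h1 := setLIntegral_map ht hg hX (μ := μ)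
  have h2 := Measure.setLIntegral_compProd (μ := μ.map X) (κ := condDistrib Y X μ) hf ht
    MeasurableSet.univ
  rw [compProd_map_condDistrib hY.aemeasurable,
    setLIntegral_map (ht.prod MeasurableSet.univ) hf hXY] at h2
  simp only [Measure.restrict_univ] at h2
  rw [← h1, ← h2, Set.mk_preimage_prod, Set.preimage_univ, Set.inter_univ]

section

variable {Ω E C : Type*} (m : MeasurableSpace Ω) {m0 : MeasurableSpace Ω} (P : Measure Ω)
  [IsFiniteMeasure P] [MeasurableSpace E] [StandardBorelSpace E] [Nonempty E]

/-- A regular conditional distribution of `Y` given the σ-algebra `m`. -/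
noncomputable def condLaw (Y : Ω → E) (ω : Ω) : Measure E :=
  -- The conditioning variable is the identity from `(Ω, m0)` to `(Ω, m)`, which generates exactly
  -- `m`.
  @condDistrib Ω Ω E _ _ _ m0 m Y id P _ ω

instance isProbabilityMeasure_condLaw (Y : Ω → E) (ω : Ω) :
    IsProbabilityMeasure (condLaw m P Y ω) := by
  unfold condLaw
  infer_instance

variable {m P} [MeasurableSpace C]

/-- An `m`-measurable `c` can be frozen under the conditional law. This handles the random centering
and scaling. -/
theorem condLExp_ae_eq_lintegral_condLaw (hm : m ≤ m0) {Y : Ω → E} (hY : Measurable Y)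
    {c : Ω → C} (hc : Measurable[m] c) {f : C × E → ℝ≥0∞} (hf : Measurable f) :
    condLExp m P (fun ω => f (c ω, Y ω)) =ᵐ[P]
      fun ω => ∫⁻ y, f (c ω, y) ∂(condLaw m P Y ω) := by
  have h := @lintegral_condDistrib_ae_eq_condLExp Ω Ω E _ _ _ m0 m P _ id Y
    (measurable_id'' hm) hY (fun z => f (c z.1, z.2))
    (hf.comp ((hc.comp (@measurable_fst _ _ m _)).prodMk (@measurable_snd _ _ m _)))
  rw [MeasurableSpace.comap_id] at h
  exact h.symm

theorem condProb_ae_eq_condLaw (hm : m ≤ m0) {Y : Ω → E} (hY : Measurable Y)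
    {c : Ω → C} (hc : Measurable[m] c) {s : Set (C × E)} (hs : MeasurableSet s) :
    P⟦{ω | (c ω, Y ω) ∈ s} | m⟧ =ᵐ[P]
      fun ω => (condLaw m P Y ω).real {y | (c ω, y) ∈ s} := by
  have hmeas : Measurable fun ω => s.indicator (1 : C × E → ℝ≥0∞) (c ω, Y ω) :=
    (measurable_one.indicator hs).comp ((hc.mono hm le_rfl).prodMk hY)
  have h1 := condLExp_ae_eq_lintegral_condLaw (P := P) hm hY hc
    (f := s.indicator 1) (measurable_one.indicator hs)
  have h2 := toReal_condLExp m (μ := P) (f := fun ω => s.indicator (1 : C × E → ℝ≥0∞) (c ω, Y ω))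
    hmeas.aemeasurable (ne_top_of_le_ne_top (measure_ne_top P Set.univ) <| by
      rw [← lintegral_one]
      exact lintegral_mono fun ω => Set.indicator_le_self' (by simp) _)
  have h3 : (fun ω => (s.indicator (1 : C × E → ℝ≥0∞) (c ω, Y ω)).toReal) =
      {ω | (c ω, Y ω) ∈ s}.indicator fun _ => (1 : ℝ) := by
    ext ω
    by_cases h : (c ω, Y ω) ∈ s <;> simp [h]
  rw [h3] at h2
  filter_upwards [h1, h2] with ω a b
  rw [← b, a, measureReal_def, ← lintegral_indicator_one]
  · rfl
  · exact measurable_prodMk_left hs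

theorem condProb_preimage_ae_eq_condLaw (hm : m ≤ m0) {Y : Ω → E} (hY : Measurable Y)
    {s : Set E} (hs : MeasurableSet s) :
    P⟦Y ⁻¹' s | m⟧ =ᵐ[P] fun ω => (condLaw m P Y ω).real s :=
  condProb_ae_eq_condLaw (c := fun _ => ()) (s := Prod.snd ⁻¹' s) hm hY measurable_const
    (measurable_snd hs)

end

/-! ### Conditional independence as a product law -/

/-- Two finite measures on `ι → ℝ`, one of them a product, agree if they agree on the products of
half-lines with rational endpoints. -/
theorem pi_eq_of_rat_Iic {ι : Type*} [Fintype ι] {κ : ι → Measure ℝ} [∀ i, IsFiniteMeasure (κ i)]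
    {μ : Measure (ι → ℝ)}
    (h : ∀ q : ι → ℚ, μ (Set.univ.pi fun i => Set.Iic (q i : ℝ)) = ∏ i, κ i (Set.Iic (q i : ℝ))) :
    Measure.pi κ = μ := by
  refine Measure.pi_eq_generateFrom (C := fun _ => ⋃ a : ℚ, {Set.Iic (a : ℝ)})
    (fun _ => ?_) (fun _ => Real.isPiSystem_Iic_rat) (fun i => ?_) fun s hs => ?_
  · rw [← Real.borel_eq_generateFrom_Iic_rat]
    exact BorelSpace.measurable_eq.symm
  · exact
      { set := fun n => Set.Iic (((n : ℚ) : ℝ))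
        set_mem := fun n => Set.mem_iUnion.2 ⟨n, rfl⟩
        finite := fun n => measure_lt_top _ _
        spanning := Set.iUnion_eq_univ_iff.2 fun x => by
          obtain ⟨n, hn⟩ := exists_nat_ge x
          exact ⟨n, by simpa using hn⟩ }
  · simp only [Set.mem_iUnion, Set.mem_singleton_iff] at hs
    choose q hq using hs
    obtain rfl : s = fun i => Set.Iic (q i : ℝ) := funext hq
    exact h q

theorem condLaw_ae_eq_pi {Ω ι : Type*} [Fintype ι] {m m0 : MeasurableSpace Ω} {P : Measure Ω}
    [IsFiniteMeasure P] (hm : m ≤ m0) {X : ι → Ω → ℝ} (hX : ∀ i, Measurable (X i))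
    (hind : CondIndependent m P X) :
    ∀ᵐ ω ∂P, condLaw m P (fun ω i => X i ω) ω =
      Measure.pi fun i => (condLaw m P (fun ω i => X i ω) ω).map fun x => x i := by
  have hY : Measurable fun ω i => X i ω := measurable_pi_lambda _ hX
  -- Conditional independence holds off a null set depending on the Borel sets; rational half-lines
  -- leave only countably many null sets to discard.
  have h : ∀ q : ι → ℚ, ∀ᵐ ω ∂P,
      (condLaw m P (fun ω i => X i ω) ω).real (Set.univ.pi fun i => Set.Iic (q i : ℝ)) =
        ∏ i, (condLaw m P (fun ω i => X i ω) ω).real ((fun x => x i) ⁻¹' Set.Iic (q i : ℝ)) := by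
    intro q
    have h1 := condProb_preimage_ae_eq_condLaw (P := P) hm hY
      (s := Set.univ.pi fun i => Set.Iic (q i : ℝ)) (.univ_pi fun i => measurableSet_Iic)
    have h2 : ∀ i, P⟦X i ⁻¹' Set.Iic (q i : ℝ) | m⟧ =ᵐ[P] fun ω =>
        (condLaw m P (fun ω i => X i ω) ω).real ((fun x => x i) ⁻¹' Set.Iic (q i : ℝ)) :=
      fun i => condProb_preimage_ae_eq_condLaw (P := P) hm hY
        (s := (fun x : ι → ℝ => x i) ⁻¹' Set.Iic (q i : ℝ))
        (measurable_pi_apply i measurableSet_Iic)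
    have h3 := hind (fun i => Set.Iic (q i : ℝ)) fun i => measurableSet_Iic
    have h4 : (fun ω i => X i ω) ⁻¹' (Set.univ.pi fun i => Set.Iic (q i : ℝ)) =
        ⋂ i, X i ⁻¹' Set.Iic (q i : ℝ) := by
      ext ω
      simp [Pi.le_def]
    rw [h4] at h1
    filter_upwards [h1, h3, ae_all_iff.2 h2] with ω a b c
    rw [← a, b, Finset.prod_apply]
    exact Finset.prod_congr rfl fun i _ => c i
  filter_upwards [ae_all_iff.2 h] with ω hω
  have : ∀ i : ι, IsProbabilityMeasure ((condLaw m P (fun ω i => X i ω) ω).map fun x => x i) :=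
    fun i => Measure.isProbabilityMeasure_map (measurable_pi_apply i).aemeasurable
  refine (pi_eq_of_rat_Iic fun q => ?_).symm
  simp_rw [Measure.map_apply (measurable_pi_apply _) measurableSet_Iic]
  rw [← ENNReal.toReal_eq_toReal_iff' (measure_ne_top _ _)
    (ENNReal.prod_ne_top fun i _ => measure_ne_top _ _), ENNReal.toReal_prod]
  exact hω q

/-! ### Conditional moments as moments of the conditional law -/

section

variable {Ω ι : Type*} {m m0 : MeasurableSpace Ω} {P : Measure Ω}

theorem measurable_condMean (X : Ω → ℝ) : Measurable[m] (condMean m P X) :=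
  ((measurable_condLExp m P _).ennreal_toReal).sub ((measurable_condLExp m P _).ennreal_toReal)

variable [Fintype ι]

theorem measurable_condScale (X : ι → Ω → ℝ) : Measurable[m] (condScale m P X) :=
  Measurable.pow_const (Finset.measurable_sum _ fun _ _ => measurable_condLExp m P _) _

variable [IsFiniteMeasure P]

theorem condCentralMoment_ae_eq (hm : m ≤ m0) {X : ι → Ω → ℝ} (hX : ∀ i, Measurable (X i))
    (p : ℝ) (i : ι) :
    condCentralMoment m P (X i) p =ᵐ[P] fun ω =>
      ∫⁻ x, ‖x - condMean m P (X i) ω‖ₑ ^ p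
        ∂((condLaw m P (fun ω i => X i ω) ω).map fun x => x i) := by
  have h := condLExp_ae_eq_lintegral_condLaw (P := P) hm (Y := fun ω i => X i ω)
    (measurable_pi_lambda _ hX) (measurable_condMean (P := P) (X i))
    (f := fun z => ‖z.2 i - z.1‖ₑ ^ p) (by fun_prop)
  filter_upwards [h] with ω hω
  rw [lintegral_map (by fun_prop) (by fun_prop)]
  exact hω

theorem condMean_ae_eq (hm : m ≤ m0) {X : ι → Ω → ℝ} (hX : ∀ i, Measurable (X i)) (i : ι)
    (hvar : ∀ᵐ ω ∂P, condVariance m P (X i) ω < ∞) :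
    ∀ᵐ ω ∂P, ∫ x, x ∂((condLaw m P (fun ω i => X i ω) ω).map fun x => x i) =
      condMean m P (X i) ω := by
  have h : ∀ f : ℝ → ℝ, Measurable f →
      condLExp m P (fun ω => ENNReal.ofReal (f (X i ω))) =ᵐ[P] fun ω =>
        ∫⁻ x, ENNReal.ofReal (f x) ∂((condLaw m P (fun ω i => X i ω) ω).map fun x => x i) := by
    intro f hf
    have h := condLExp_ae_eq_lintegral_condLaw (P := P) hm (Y := fun ω i => X i ω)
      (measurable_pi_lambda _ hX) (c := fun _ => ()) measurable_const
      (f := fun z => ENNReal.ofReal (f (z.2 i))) (by fun_prop)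
    filter_upwards [h] with ω hω
    rw [lintegral_map (by fun_prop) (by fun_prop)]
    exact hω
  filter_upwards [h id measurable_id, h Neg.neg measurable_neg,
    condCentralMoment_ae_eq (P := P) hm hX 2 i, hvar] with ω hpos hneg hV hfin
  have hprob : IsProbabilityMeasure ((condLaw m P (fun ω i => X i ω) ω).map fun x => x i) :=
    Measure.isProbabilityMeasure_map (measurable_pi_apply i).aemeasurable
  rw [condVariance, hV] at hfin
  -- Finite conditional variance makes the marginal law integrable, so its mean splits into the two
  -- parts defining `condMean`.
  rw [integral_eq_lintegral_pos_part_sub_lintegral_neg_part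
    (integrable_of_lintegral_sub_sq_ne_top measurable_id' hfin.ne), condMean]
  simp only [id_eq] at hpos
  rw [hpos, hneg]

theorem condProb_standardizedSum_ae_eq (hm : m ≤ m0) {X : ι → Ω → ℝ} (hX : ∀ i, Measurable (X i))
    (t : ℝ) :
    P⟦{ω | standardizedSum m P X ω ≤ t} | m⟧ =ᵐ[P] fun ω =>
      (condLaw m P (fun ω i => X i ω) ω).real
        {x | (condScale m P X ω).toReal⁻¹ * ∑ i, (x i - condMean m P (X i) ω) ≤ t} :=
  condProb_ae_eq_condLaw (P := P) hm (Y := fun ω i => X i ω) (measurable_pi_lambda _ hX)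
    (c := fun ω => ((condScale m P X ω), fun i => condMean m P (X i) ω))
    ((measurable_condScale X).prodMk
      (@measurable_pi_lambda _ _ _ m _ _ fun i => measurable_condMean (X i)))
    (s := {z : (ℝ≥0∞ × (ι → ℝ)) × (ι → ℝ) | z.1.1.toReal⁻¹ * ∑ i, (z.2 i - z.1.2 i) ≤ t})
    (measurableSet_le (by fun_prop) measurable_const)

end

/-! ### Transfer to the conditional setting -/

/-- If the conditional Lyapunov ratio is small, then the conditional distribution function of the
standardized sum is close to the standard normal one, uniformly over all probability spaces. -/
theorem exists_conditional_lyapunov_bound {δ : ℝ} (hδ : 0 < δ) (t : ℝ) {ε : ℝ} (hε : 0 < ε) :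
    ∃ η : ℝ≥0∞, 0 < η ∧ ∀ {Ω : Type*} {m m0 : MeasurableSpace Ω} {P : Measure Ω}
      [IsProbabilityMeasure P] {n : ℕ} {X : Fin n → Ω → ℝ}, m ≤ m0 → n ≠ 0 →
      (∀ i, Measurable (X i)) → CondIndependent m P X →
      (∀ i, ∀ᵐ ω ∂P, 0 < condVariance m P (X i) ω ∧ condVariance m P (X i) ω < ∞) →
      ∀ᵐ ω ∂P, lyapunovRatio m P X δ ω < η →
        dist ((P⟦{ω | standardizedSum m P X ω ≤ t} | m⟧) ω) (cdf (gaussianReal 0 1) t) < ε := by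
  obtain ⟨η, hη, H⟩ := exists_lyapunov_bound_of_lintegral hδ t hε
  refine ⟨η, hη, fun {Ω m m0 P _ n X} hm hn hX hind hvar => ?_⟩
  filter_upwards [condProb_standardizedSum_ae_eq (P := P) hm hX t,
    condLaw_ae_eq_pi hm hX hind, ae_all_iff.2 (condCentralMoment_ae_eq (P := P) hm hX 2),
    ae_all_iff.2 (condCentralMoment_ae_eq (P := P) hm hX (2 + δ)),
    ae_all_iff.2 fun i => condMean_ae_eq hm hX i ((hvar i).mono fun ω h => h.2),
    ae_all_iff.2 hvar] with ω hT hpi h2 h3 hmean hV hlt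
  have hprob : ∀ i, IsProbabilityMeasure
      ((condLaw m P (fun ω i => X i ω) ω).map fun x : Fin n → ℝ => x i) := fun i =>
    Measure.isProbabilityMeasure_map (measurable_pi_apply i).aemeasurable
  rw [hT, hpi]
  refine H n _ hprob (fun i => condMean m P (X i) ω) (condScale m P X ω) hmean ?_ ?_ ?_ ?_
  · simp only [condScale, condVariance, h2]
  -- With `n ≠ 0` there is at least one strictly positive variance, so the scale is nonzero.
  · have hpos : 0 < ∑ i, condVariance m P (X i) ω :=
      (hV ⟨0, Nat.pos_of_ne_zero hn⟩).1.trans_le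
        (Finset.single_le_sum (f := fun i => condVariance m P (X i) ω) (fun _ _ => zero_le)
          (Finset.mem_univ _))
    simp [condScale, hpos.ne']
  · exact ENNReal.rpow_ne_top_of_nonneg (by norm_num) (ENNReal.sum_ne_top.2 fun i _ => (hV i).2.ne)
  · simpa only [lyapunovRatio, h3] using hlt

end CondCLT

theorem mainTheorem11 {Ω : ℕ → Type*} (F : ∀ n, MeasurableSpace (Ω n))
    [mΩ : ∀ n, MeasurableSpace (Ω n)] (hF : ∀ n, F n ≤ mΩ n)
    (P : ∀ n, Measure (Ω n)) [∀ n, IsProbabilityMeasure (P n)]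
    (W : ∀ n, Fin n → Ω n → ℝ) (hW : ∀ n i, Measurable (W n i))
    (hind : ∀ n, CondCLT.CondIndependent (F n) (P n) (W n))
    (hvar : ∀ n i, ∀ᵐ ω ∂(P n), 0 < CondCLT.condVariance (F n) (P n) (W n i) ω ∧
      CondCLT.condVariance (F n) (P n) (W n i) ω < ∞)
    (δ : ℝ) (hδ : 0 < δ)
    (hlyap : CondCLT.TendstoInProb P
      (fun n => CondCLT.lyapunovRatio (F n) (P n) (W n) δ) 0) :
    CondCLT.CondTendstoInDistribution F P
      (fun n => CondCLT.standardizedSum (F n) (P n) (W n)) (gaussianReal 0 1) := by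
  intro t _ ε hε
  -- The tolerance `ε` lies in `[0, ∞]` and may be infinite; a positive real below it is enough.
  obtain ⟨r, hr0, hr⟩ : ∃ r : ℝ, 0 < r ∧ ENNReal.ofReal r ≤ ε := by
    obtain ⟨r, hr0, hr⟩ := ENNReal.lt_iff_exists_nnreal_btwn.1 hε
    exact ⟨r, by exact_mod_cast hr0, by simpa using hr.le⟩
  obtain ⟨η, hη, H⟩ := CondCLT.exists_conditional_lyapunov_bound hδ t hr0
  refine tendsto_of_tendsto_of_tendsto_of_le_of_le' tendsto_const_nhds (hlyap η hη)
    (Eventually.of_forall fun n => zero_le) ?_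
  -- The empty row `n = 0` has scale 0 and is skipped.
  filter_upwards [eventually_ne_atTop 0] with n hn
  refine measure_mono_ae ?_
  filter_upwards [H (hF n) hn (hW n) (hind n) (hvar n)] with ω hω hfar
  change η ≤ edist (CondCLT.lyapunovRatio (F n) (P n) (W n) δ ω) 0
  rw [CondCLT.edist_ennreal_zero]
  by_contra! hlt
  refine absurd (hω hlt) (not_lt.2 ?_)
  have h : ENNReal.ofReal r ≤ edist _ _ := hr.trans hfar
  rwa [edist_dist, ENNReal.ofReal_le_ofReal_iff dist_nonneg] at h
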